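/- Let $X$ and $Y$ be real Banach spaces with $Y\neq\{0\}$, let $\varepsilon\ge 0$, and let $f:X\to Y$ satisfy $f(0)=0$ and $\bigl|\,\|f(x)-f(y)\|-\|x-y\|\,\bigr|\le\varepsilon$ for all $x,y\in X$. Let $\mathrm{Ext}(B_{X^*})$ be the set of extreme points of the closed unit ball of $X^*$, with its relative $w^*$-topology. For $\Omega\subset \mathrm{Ext}(B_{X^*})$, let $\ell_\infty(\Omega)$ be the space of bounded real functions on $\Omega$ with the supremum norm, and $C(\Omega,w^*)$ its subspace of $w^*$-continuous functions. Each $x\in X$ is identified with the function $x^*\mapsto x^*(x)$ on $\Omega$; if $\Omega$ is $w^*$-dense in $\mathrm{Ext}(B_{X^*})$, this embeds $X$ isometrically into $C(\Omega,w^*)\subset\ell_\infty(\Omega)$. (1) For every $w^*$-dense subset $\Omega$ of $\mathrm{Ext}(B_{X^*})$ there is a bounded linear operator $T:Y\to\ell_\infty(\Omega)$ with $\|T\|=1$ such that $$\|Tf(x)-x\|_{\ell_\infty(\Omega)}\le 4\varepsilon\qquad\text{for all }x\in X.$$ (2) Suppose that $Y$ is separable, or that $Y^*$ has the $w^*$-PCP,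 i.e. for every nonempty bounded $A\subset Y^*$ and every $\delta>0$ there is a $w^*$-open $U\subset Y^*$ such that $A\cap U$ is nonempty and has norm diameter less than $\delta$. Then there are a $w^*$-dense subset $\Omega$ of $\mathrm{Ext}(B_{X^*})$ that is a $G_\delta$ in the relative $w^*$-topology of $\mathrm{Ext}(B_{X^*})$, and a bounded linear operator $T:Y\to C(\Omega,w^*)$ with $\|T\|=1$, such that $$\|Tf(x)-x\|_{C(\Omega,w^*)}\le 4\varepsilon\qquad\text{for all }x\in X.$$ -/

import Mathlib

open scoped ENNReal BoundedContinuousFunction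

/-- `f : X → Y` is a standard `ε`-isometry: `f 0 = 0` and
`|‖f x - f y‖ - ‖x - y‖| ≤ ε` for all `x, y`. -/
structure IsStandardEpsIsometry {X Y : Type*} [NormedAddCommGroup X] [NormedAddCommGroup Y]
    (ε : ℝ) (f : X → Y) : Prop where
  map_zero : f 0 = 0
  abs_sub_le : ∀ x y : X, |‖f x - f y‖ - ‖x - y‖| ≤ ε

/-- The set `Ext (B_{X*})` of extreme points of the closed unit ball of the dual of `X`, as a subset
of the dual with its weak-star topology. -/
def dualBallExt (X : Type*) [NormedAddCommGroup X] [NormedSpace ℝ X] : Set (WeakDual ℝ X) :=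
  Set.extremePoints ℝ (WeakDual.toStrongDual ⁻¹' Metric.closedBall (0 : StrongDual ℝ X) 1)

/-- `Ω` is a weak-star dense subset of `Ext (B_{X*})`. -/
structure IsWeakStarDenseInExt {X : Type*} [NormedAddCommGroup X] [NormedSpace ℝ X]
    (Ω : Set (WeakDual ℝ X)) : Prop where
  subset : Ω ⊆ dualBallExt X
  dense : dualBallExt X ⊆ closure Ω

/-- `Y*` has the point of weak-star to norm continuity property: every nonempty bounded subset of
`Y*` has nonempty relatively weak-star open subsets of arbitrarily small norm diameter. -/
def HasWeakStarPCP (Y : Type*) [NormedAddCommGroup Y] [NormedSpace ℝ Y] : Prop :=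
  ∀ A : Set (StrongDual ℝ Y), A.Nonempty → Bornology.IsBounded A → ∀ δ : ℝ, 0 < δ →
    ∃ U : Set (WeakDual ℝ Y), IsOpen U ∧
      (A ∩ StrongDual.toWeakDual ⁻¹' U).Nonempty ∧
      Metric.diam (A ∩ StrongDual.toWeakDual ⁻¹' U) < δ

theorem norm_apply_le_of_mem_dualBallExt {X : Type*} [NormedAddCommGroup X] [NormedSpace ℝ X]
    {ω : WeakDual ℝ X} (hω : ω ∈ dualBallExt X) (x : X) : ‖ω x‖ ≤ ‖x‖ := by
  have h : ‖WeakDual.toStrongDual ω‖ ≤ 1 := by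
    simpa [dualBallExt] using hω.1
  simpa using (WeakDual.toStrongDual ω).le_of_opNorm_le h x

noncomputable section

/-- The canonical map `X → ℓ∞(Ω)`, `x ↦ (ω x)_{ω ∈ Ω}`, for `Ω ⊆ Ext (B_{X*})`; it is a linear
isometric embedding when `Ω` is weak-star dense in `Ext (B_{X*})`, and this is how `X` is regarded
as a subspace of `ℓ∞(Ω)`. -/
def canonicalLinfty {X : Type*} [NormedAddCommGroup X] [NormedSpace ℝ X]
    {Ω : Set (WeakDual ℝ X)} (hΩ : Ω ⊆ dualBallExt X) (x : X) : lp (fun _ : Ω => ℝ) ∞ :=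
  ⟨fun ω => (ω : WeakDual ℝ X) x, memℓp_infty ⟨‖x‖, by
    rintro _ ⟨ω, rfl⟩
    exact norm_apply_le_of_mem_dualBallExt (hΩ ω.2) x⟩⟩

/-- The canonical map of `X` into the space `C(Ω, w*)` of bounded weak-star continuous real
functions on `Ω`, `x ↦ (ω ↦ ω x)`, for `Ω ⊆ Ext (B_{X*})`; it is a linear isometric embedding
(for the supremum norm) when `Ω` is weak-star dense in `Ext (B_{X*})`. -/
def canonicalBCF {X : Type*} [NormedAddCommGroup X] [NormedSpace ℝ X]
    {Ω : Set (WeakDual ℝ X)} (hΩ : Ω ⊆ dualBallExt X) (x : X) : Ω →ᵇ ℝ :=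
  BoundedContinuousFunction.ofNormedAddCommGroup (fun ω : Ω => (ω : WeakDual ℝ X) x)
    ((WeakDual.eval_continuous x).comp continuous_subtype_val) ‖x‖
    (fun ω => norm_apply_le_of_mem_dualBallExt (hΩ ω.2) x)

end

/-! The core is a stability estimate: each functional `s` in the unit ball of `X*` admits `φ` in the
unit ball of `Y*` with `|φ (f x) - s x| ≤ 4ε` for all `x`. If `s` is the derivative of the norm at a
smooth point `u`, then `φ` is a weak-star limit of functionals norming the increments `f (r u) - f
(-r u)`. In finite dimensions smooth points are dense, so such derivatives norm `X`; the set of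
representable `s` is convex and weak-star closed, hence by Hahn–Banach contains the ball. Weak-star
compactness of the ball of `Y*` passes from finite-dimensional subspaces to `X`.

Choosing `g ω` for each `ω ∈ Ω` and putting `(T y) ω = g ω y` gives (1). The norm is at most one by
construction, and at least one because `f` preserves large norms up to `ε` and `Ω` norms `X` by
Krein–Milman.

For (2), `g` must be weak-star continuous. The pairs `(ω, φ)` form a closed relation over `Ext
(B_{X*})`, a Baire space by Choquet, with values in a compact space fragmented by a suitable
distance. A minimal closed subrelation has arbitrarily small values on dense open sets, so it has a
continuous selection on a dense Gδ. -/

/-! ### Choquet: extreme points of a compact convex set form a Baire space. -/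

section ExtremePoints

open Set Filter Topology

variable {E : Type*} [AddCommGroup E] [Module ℝ E] [TopologicalSpace E] [T2Space E]
  [IsTopologicalAddGroup E] [ContinuousSMul ℝ E] [LocallyConvexSpace ℝ E] {K : Set E}

/-- A relatively open convex proper subset of a compact convex set misses some extreme point. -/
theorem exists_mem_extremePoints_notMem (hK : IsCompact K) (hKc : Convex ℝ K) {A : Set E}
    (hAK : A ⊆ K) (hA : Convex ℝ A) (hcl : IsClosed (K \ A)) (hne : (K \ A).Nonempty) :
    ∃ x ∈ K.extremePoints ℝ, x ∉ A := by
  let S : Set (Set E) := {B | B ⊆ K ∧ Convex ℝ B ∧ IsClosed (K \ B) ∧ (K \ B).Nonempty}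
  obtain ⟨M, hAM, hM⟩ : ∃ M, A ⊆ M ∧ Maximal (· ∈ S) M := by
    refine zorn_subset_nonempty S (fun c hcS hc hcne => ?_) A ⟨hAK, hA, hcl, hne⟩
    refine ⟨⋃₀ c, ⟨sUnion_subset fun B hB => (hcS hB).1,
      hc.directedOn.convex_sUnion fun B hB => (hcS hB).2.1, ?_⟩,
      fun B hB => subset_sUnion_of_mem hB⟩
    have : Nonempty c := hcne.to_subtype
    have heq : K \ ⋃₀ c = ⋂ B : c, K \ (B : Set E) := by
      rw [sUnion_eq_iUnion, sdiff_iUnion]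
    rw [heq]
    refine ⟨isClosed_iInter fun B => (hcS B.2).2.2.1, ?_⟩
    refine IsCompact.nonempty_iInter_of_directed_nonempty_isCompact_isClosed _ (fun B C => ?_)
      (fun B => (hcS B.2).2.2.2)
      (fun B => hK.of_isClosed_subset (hcS B.2).2.2.1 sdiff_subset) fun B => (hcS B.2).2.2.1
    obtain h | h := hc.total B.2 C.2
    · exact ⟨C, sdiff_subset_sdiff_right h, Subset.rfl⟩
    · exact ⟨B, Subset.rfl, sdiff_subset_sdiff_right h⟩
  obtain ⟨hMK, hMc, hMcl, p, hpK, hpM⟩ := hM.prop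
  -- Otherwise the preimage of `M` under the contraction `z ↦ s a + t z` is a proper competitor
  -- containing `M`, so it equals `M` by maximality. The contraction then preserves the closed set
  -- `K \ M`, and its iterates from `p` converge to `a ∈ M`.
  have key : ∀ a ∈ M, ∀ y ∈ K, ∀ s t : ℝ, 0 < s → 0 ≤ t → s + t = 1 → s • a + t • y ∈ M := by
    intro a ha y hy s t hs ht hst
    by_contra hcon
    have hmap : ∀ z ∈ K, s • a + t • z ∈ K := fun z hz => hKc (hMK ha) hz hs.le ht hst
    have hP : {z | z ∈ K ∧ s • a + t • z ∈ M} ∈ S := by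
      refine ⟨fun z hz => hz.1, ?_, ?_, y, hy, fun h => hcon h.2⟩
      · rintro z ⟨hz, hz'⟩ w ⟨hw, hw'⟩ α β hα hβ hαβ
        refine ⟨hKc hz hw hα hβ hαβ, ?_⟩
        have := hMc hz' hw' hα hβ hαβ
        convert this using 1
        obtain rfl : α = 1 - β := by linarith
        module
      · have : K \ {z | z ∈ K ∧ s • a + t • z ∈ M} =
            K ∩ (fun z => s • a + t • z) ⁻¹' (K \ M) := by
          ext z
          constructor
          · rintro ⟨hz, h⟩
            exact ⟨hz, hmap z hz, fun h' => h ⟨hz, h'⟩⟩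
          · rintro ⟨hz, h⟩
            exact ⟨hz, fun h' => h.2 h'.2⟩
        rw [this]
        exact hK.isClosed.inter (hMcl.preimage (by fun_prop))
    have hPM : {z | z ∈ K ∧ s • a + t • z ∈ M} ⊆ M :=
      hM.2 hP fun z hz => ⟨hMK hz, hMc ha hz hs.le ht hst⟩
    have hiter : ∀ n : ℕ, a + t ^ n • (p - a) ∈ K \ M := by
      intro n
      induction n with
      | zero => simpa using ⟨hpK, hpM⟩
      | succ n ih =>
        have : a + t ^ (n + 1) • (p - a) = s • a + t • (a + t ^ n • (p - a)) := by
          obtain rfl : s = 1 - t := by linarith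
          rw [pow_succ]
          module
        rw [this]
        exact ⟨hmap _ ih.1, fun h => ih.2 (hPM ⟨ih.1, h⟩)⟩
    have hlim : Tendsto (fun n : ℕ => a + t ^ n • (p - a)) atTop (𝓝 (a + (0 : ℝ) • (p - a))) :=
      tendsto_const_nhds.add
        ((tendsto_pow_atTop_nhds_zero_of_lt_one ht (by linarith)).smul_const _)
    rw [zero_smul, add_zero] at hlim
    exact (hMcl.mem_of_tendsto hlim (Eventually.of_forall hiter)).2 ha
  -- A second point `q` could be separated from `p`. Adding to `M` the open half of `K` on the side
  -- of `p` keeps it convex, by `key`, and proper, against maximality.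
  have huniq : ∀ q ∈ K, q ∉ M → q = p := by
    intro q hqK hqM
    by_contra hqp
    obtain ⟨l, hl⟩ := geometric_hahn_banach_point_point (Ne.symm hqp)
    have hlc : IsClosed {y | (l p + l q) / 2 ≤ l y} := isClosed_le continuous_const l.continuous
    have hS : M ∪ {y | y ∈ K ∧ l y < (l p + l q) / 2} ∈ S := by
      refine ⟨union_subset hMK fun y hy => hy.1, ?_, ?_, q, hqK, ?_⟩
      · rw [convex_iff_forall_pos]
        rintro y hy z hz s t hs ht hst
        have hyK : y ∈ K := hy.elim (fun h => hMK h) fun h => h.1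
        have hzK : z ∈ K := hz.elim (fun h => hMK h) fun h => h.1
        rcases hy with hy | hy
        · exact Or.inl (key y hy z hzK s t hs ht.le hst)
        rcases hz with hz | hz
        · rw [add_comm (s • y)]
          exact Or.inl (key z hz y hyK t s ht hs.le (by linarith))
        · refine Or.inr ⟨hKc hyK hzK hs.le ht.le hst, ?_⟩
          have h1 := mul_lt_mul_of_pos_left hy.2 hs
          have h2 := mul_lt_mul_of_pos_left hz.2 ht
          have h3 : s * ((l p + l q) / 2) + t * ((l p + l q) / 2) = (l p + l q) / 2 := by
            rw [← add_mul, hst, one_mul]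
          simp only [map_add, map_smul, smul_eq_mul]
          linarith
      · have : K \ (M ∪ {y | y ∈ K ∧ l y < (l p + l q) / 2}) =
            (K \ M) ∩ {y | (l p + l q) / 2 ≤ l y} := by
          ext z
          simp only [Set.mem_sdiff, mem_union, mem_ofPred_eq, mem_inter_iff, not_or, not_and, not_lt]
          tauto
        rw [this]
        exact hMcl.inter hlc
      · rintro (h | h)
        · exact hqM h
        · have := h.2
          linarith
    refine hpM (hM.2 hS subset_union_left (Or.inr ⟨hpK, ?_⟩))
    linarith
  refine ⟨p, mem_extremePoints_iff_left.2 ⟨hpK, fun y hy z hz hp => ?_⟩, fun h => hpM (hAM h)⟩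
  by_contra hyp
  obtain ⟨s, t, hs, ht, hst, rfl⟩ := hp
  exact hpM (key y (by_contra fun h => hyp (huniq y hy h)) z hz s t hs ht.le hst)

/-- **Choquet's lemma**: slices form a neighbourhood base at an extreme point. -/
theorem exists_slice_subset_of_mem_extremePoints (hK : IsCompact K) {x : E}
    (hKc : Convex ℝ K) (hx : x ∈ K.extremePoints ℝ) {V : Set E} (hV : IsOpen V) (hxV : x ∈ V) :
    ∃ (l : StrongDual ℝ E) (u : ℝ), l x < u ∧ ∀ y ∈ K, l y ≤ u → y ∈ V := by
  -- Closed half-spaces that miss `x` cover `K \ V` locally. Convex joins merge finitely many pieces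
  -- without reaching `x`, since an extreme point lies on a segment of `K` only as an endpoint.
  obtain ⟨C, hC, hCc, hCK, hsub, hxC⟩ : ∃ C : Set E, IsCompact C ∧ Convex ℝ C ∧ C ⊆ K ∧
      K \ V ⊆ C ∧ x ∉ C := by
    refine (hK.diff hV).induction_on
      (p := fun B => ∃ C : Set E, IsCompact C ∧ Convex ℝ C ∧ C ⊆ K ∧ B ⊆ C ∧ x ∉ C)
      ⟨∅, isCompact_empty, convex_empty, empty_subset _, Subset.rfl, notMem_empty _⟩ ?_ ?_ ?_
    · rintro s t hst ⟨C, h1, h2, h3, h4, h5⟩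
      exact ⟨C, h1, h2, h3, hst.trans h4, h5⟩
    · rintro s t ⟨C, h1, h2, h3, h4, h5⟩ ⟨D, g1, g2, g3, g4, g5⟩
      rcases C.eq_empty_or_nonempty with rfl | hCne
      · exact ⟨D, g1, g2, g3, union_subset (h4.trans (empty_subset _)) g4, g5⟩
      rcases D.eq_empty_or_nonempty with rfl | hDne
      · exact ⟨C, h1, h2, h3, union_subset h4 (g4.trans (empty_subset _)), h5⟩
      refine ⟨convexJoin ℝ C D, ?_, h2.convexJoin g2, 
        convexJoin_subset h3 g3 hKc,
        union_subset (h4.trans (subset_convexJoin_left hDne))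
          (g4.trans (subset_convexJoin_right hCne)), ?_⟩
      · have : convexJoin ℝ C D =
            (fun q : ℝ × E × E => (1 - q.1) • q.2.1 + q.1 • q.2.2) '' (Icc 0 1 ×ˢ C ×ˢ D) := by
          ext z
          simp only [mem_convexJoin, segment_eq_image, mem_image, mem_prod, Prod.exists]
          constructor
          · rintro ⟨a, ha, b, hb, t, ht, rfl⟩
            exact ⟨t, a, b, ⟨ht, ha, hb⟩, rfl⟩
          · rintro ⟨t, a, b, ⟨ht, ha, hb⟩, rfl⟩
            exact ⟨a, ha, b, hb, t, ht, rfl⟩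
        rw [this]
        exact (isCompact_Icc.prod (h1.prod g1)).image (by fun_prop)
      · rw [mem_convexJoin]
        rintro ⟨a, ha, b, hb, hab⟩
        rw [mem_extremePoints_iff_forall_segment] at hx
        rcases hx.2 a (h3 ha) b (g3 hb) hab with rfl | rfl
        · exact h5 ha
        · exact g5 hb
    · intro b hb
      have hbx : x ≠ b := fun h => hb.2 (h ▸ hxV)
      obtain ⟨l, hl⟩ := geometric_hahn_banach_point_point hbx
      have ho : IsOpen {y | (l x + l b) / 2 < l y} := isOpen_lt continuous_const l.continuous
      refine ⟨(K \ V) ∩ {y | (l x + l b) / 2 < l y}, inter_mem self_mem_nhdsWithin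
        (mem_nhdsWithin_of_mem_nhds (ho.mem_nhds (show (l x + l b) / 2 < l b by linarith))),
        K ∩ {y | (l x + l b) / 2 ≤ l y}, ?_, ?_, inter_subset_left, ?_, ?_⟩
      · exact hK.inter_right (isClosed_le continuous_const l.continuous)
      · exact hKc.inter (convex_halfSpace_ge l.toLinearMap.isLinear _)
      · exact fun y hy => ⟨hy.1.1, (show (l x + l b) / 2 < l y from hy.2).le⟩
      · rintro ⟨-, h⟩
        have : (l x + l b) / 2 ≤ l x := h
        linarith
  obtain ⟨l, u, h1, h2⟩ := geometric_hahn_banach_point_closed hCc hC.isClosed hxC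
  refine ⟨l, u, h1, fun y hy hyu => by_contra fun hyV => ?_⟩
  exact absurd (h2 y (hsub ⟨hy, hyV⟩)) (not_lt.2 hyu)

/-- **Choquet**: the extreme points of a compact convex set form a Baire space. -/
theorem baireSpace_extremePoints (hK : IsCompact K) (hKc : Convex ℝ K) :
    BaireSpace (K.extremePoints ℝ) := by
  refine ⟨fun U hUo hUd => ?_⟩
  choose G hGo hGU using fun n => isOpen_induced_iff.1 (hUo n)
  rw [dense_iff_inter_open]
  rintro W hW ⟨x₀, hx₀⟩
  obtain ⟨V, hVo, rfl⟩ := isOpen_induced_iff.1 hW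
  let S := {s : StrongDual ℝ E × ℝ // ∃ x ∈ K.extremePoints ℝ, s.1 x < s.2}
  have hinit : ∃ s : S, ∀ y ∈ K, s.1.1 y ≤ s.1.2 → y ∈ V := by
    obtain ⟨l, u, h1, h2⟩ := exists_slice_subset_of_mem_extremePoints hK hKc x₀.2 hVo hx₀
    exact ⟨⟨(l, u), x₀, x₀.2, h1⟩, h2⟩
  have hstep : ∀ (n : ℕ) (s : S), ∃ t : S, ∀ y ∈ K, t.1.1 y ≤ t.1.2 →
      s.1.1 y < s.1.2 ∧ y ∈ G n := by
    rintro n ⟨⟨l, u⟩, x, hx, hxu⟩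
    have hlo : IsOpen {y | l y < u} := isOpen_lt l.continuous continuous_const
    obtain ⟨z, hz1, hz2⟩ := (hUd n).inter_open_nonempty
      ((Subtype.val : K.extremePoints ℝ → E) ⁻¹' {y | l y < u})
      (hlo.preimage continuous_subtype_val) ⟨⟨x, hx⟩, hxu⟩
    rw [← hGU] at hz2
    obtain ⟨m, v, h1, h2⟩ := exists_slice_subset_of_mem_extremePoints hK hKc z.2
      (hlo.inter (hGo n)) ⟨hz1, hz2⟩
    exact ⟨⟨(m, v), z, z.2, h1⟩, h2⟩
  obtain ⟨s₀, hs₀⟩ := hinit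
  choose next hnext using hstep
  let s : ℕ → S := fun n => Nat.rec s₀ next n
  have hs : ∀ n, ∀ y ∈ K, (s (n + 1)).1.1 y ≤ (s (n + 1)).1.2 →
      (s n).1.1 y < (s n).1.2 ∧ y ∈ G n := fun n => hnext n (s n)
  let D : ℕ → Set E := fun n => K ∩ {y | (s n).1.1 y ≤ (s n).1.2}
  have hDcl : ∀ n, IsClosed (D n) := fun n =>
    hK.isClosed.inter (isClosed_le (s n).1.1.continuous continuous_const)
  have hDsucc : ∀ n, D (n + 1) ⊆ D n := fun n y hy => ⟨hy.1, (hs n y hy.1 hy.2).1.le⟩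
  have hDanti : Antitone D := antitone_nat_of_succ_le hDsucc
  have hDne : (⋂ n, D n).Nonempty := by
    refine IsCompact.nonempty_iInter_of_sequence_nonempty_isCompact_isClosed D hDsucc
      (fun n => ?_) (hK.of_isClosed_subset (hDcl 0) inter_subset_left) hDcl
    obtain ⟨x, hx, hxu⟩ := (s n).2
    exact ⟨x, hx.1, hxu.le⟩
  have hdiff : K \ (K \ ⋂ n, D n) = ⋂ n, D n := by
    rw [sdiff_sdiff_cancel_left]
    exact fun y hy => (mem_iInter.1 hy 0).1
  -- Compactness gives a point of `⋂ n, D n`, but not an extreme one. The complement is an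
  -- increasing union of convex sets, so it is convex, relatively open and proper, and must miss an
  -- extreme point.
  have hconv : Convex ℝ (K \ ⋂ n, D n) := by
    rw [sdiff_iInter]
    refine Directed.convex_iUnion (Monotone.directed_le fun m n h =>
      sdiff_subset_sdiff_right (hDanti h)) fun {n} => ?_
    have : K \ D n = K ∩ {y | (s n).1.2 < (s n).1.1 y} := by
      ext y
      simp only [D, Set.mem_sdiff, mem_inter_iff, mem_ofPred_eq, not_and, not_le]
      tauto
    rw [this]
    exact hKc.inter (convex_halfSpace_gt (s n).1.1.toLinearMap.isLinear _)
  obtain ⟨x, hx, hxA⟩ := exists_mem_extremePoints_notMem hK hKc sdiff_subset hconv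
    (by rw [hdiff]; exact isClosed_iInter hDcl) (by rwa [hdiff])
  have hxD : ∀ n, x ∈ D n := by
    have : x ∈ ⋂ n, D n := by_contra fun h => hxA ⟨hx.1, h⟩
    exact mem_iInter.1 this
  refine ⟨⟨x, hx⟩, hs₀ x hx.1 (hxD 0).2, mem_iInter.2 fun n => ?_⟩
  rw [← hGU]
  exact (hs n x hx.1 (hxD (n + 1)).2).2

end ExtremePoints

/-! ### Continuous selections of closed relations with fragmented values. -/

section Selection

open Set Filter Topology

variable {E B : Type*} [TopologicalSpace E] [TopologicalSpace B] [CompactSpace B]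

/-- A closed relation with nonempty fibres into a compact space contains a minimal one. -/
theorem exists_minimal_closed_relation {R : Set (E × B)} (hR : IsClosed R)
    (hne : ∀ e, ∃ b, (e, b) ∈ R) :
    ∃ M ⊆ R, Minimal (fun S : Set (E × B) => IsClosed S ∧ ∀ e, ∃ b, (e, b) ∈ S) M := by
  refine zorn_superset_nonempty {S : Set (E × B) | IsClosed S ∧ ∀ e, ∃ b, (e, b) ∈ S}
    (fun c hcS hc hcne => ?_) R ⟨hR, hne⟩
  refine ⟨⋂₀ c, ⟨isClosed_sInter fun S hS => (hcS hS).1, fun e => ?_⟩,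
    fun S hS => sInter_subset_of_mem hS⟩
  have : Nonempty c := hcne.to_subtype
  have hcl : ∀ S : c, IsClosed (Prod.mk e ⁻¹' (S : Set (E × B))) := fun S =>
    (hcS S.2).1.preimage (by fun_prop)
  obtain ⟨b, hb⟩ := IsCompact.nonempty_iInter_of_directed_nonempty_isCompact_isClosed
    (fun S : c => Prod.mk e ⁻¹' (S : Set (E × B))) (fun S T => by
      obtain h | h := hc.total S.2 T.2
      · exact ⟨S, Subset.rfl, preimage_mono h⟩
      · exact ⟨T, preimage_mono h, Subset.rfl⟩)
    (fun S => (hcS S.2).2 e) (fun S => (hcl S).isCompact) hcl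
  exact ⟨b, mem_sInter.2 fun S hS => mem_iInter.1 hb ⟨S, hS⟩⟩

/-- If every fibre over `W` had a point outside `V`, deleting `W × V` from `M` would leave a smaller
closed relation with nonempty fibres. -/
theorem Minimal.exists_isOpen_subset_of_closed_relation {M : Set (E × B)}
    (hM : Minimal (fun S : Set (E × B) => IsClosed S ∧ ∀ e, ∃ b, (e, b) ∈ S) M)
    {W : Set E} (hW : IsOpen W) {V : Set B} (hV : IsOpen V)
    (hne : ∃ e ∈ W, ∃ b ∈ V, (e, b) ∈ M) :
    ∃ W' ⊆ W, IsOpen W' ∧ W'.Nonempty ∧ ∀ e ∈ W', ∀ b, (e, b) ∈ M → b ∈ V := by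
  have hcl : IsClosed (M \ univ ×ˢ V) := hM.prop.1.sdiff (isOpen_univ.prod hV)
  refine ⟨W ∩ (Prod.fst '' (M \ univ ×ˢ V))ᶜ, inter_subset_left,
    hW.inter (isClosedMap_fst_of_compactSpace _ hcl).isOpen_compl, ?_, ?_⟩
  · by_contra hcon
    rw [not_nonempty_iff_eq_empty] at hcon
    obtain ⟨e, he, b, hb, heb⟩ := hne
    have hsub := hM.2 (y := M \ W ×ˢ V) ⟨hM.prop.1.sdiff (hW.prod hV), fun e' => by
      by_cases he' : e' ∈ W
      · have : e' ∈ Prod.fst '' (M \ univ ×ˢ V) := by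
          by_contra h
          exact (hcon ▸ (⟨he', h⟩ : e' ∈ W ∩ (Prod.fst '' (M \ univ ×ˢ V))ᶜ) :
            e' ∈ (∅ : Set E))
        obtain ⟨⟨_, b'⟩, ⟨h1, h2⟩, rfl⟩ := this
        exact ⟨b', h1, fun h => h2 ⟨mem_univ _, h.2⟩⟩
      · obtain ⟨b', hb'⟩ := hM.prop.2 e'
        exact ⟨b', hb', fun h => he' h.1⟩⟩ sdiff_subset
    exact (hsub heb).2 ⟨he, hb⟩
  · rintro e ⟨-, he⟩ b hb
    by_contra hbV
    exact he ⟨(e, b), ⟨hb, fun h => hbV h.2⟩, rfl⟩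

/-- A closed relation with nonempty fibres from a Baire space to a compact space fragmented by `ρ`,
where `ρ` controls the topology, has a continuous selection over a dense `Gδ` set. -/
theorem exists_continuous_selection_of_fragmented [BaireSpace E] {R : Set (E × B)}
    (hR : IsClosed R) (hne : ∀ e, ∃ b, (e, b) ∈ R) (ρ : B → B → ℝ)
    (hfrag : ∀ A : Set B, A.Nonempty → ∀ δ > 0, ∃ U, IsOpen U ∧ (A ∩ U).Nonempty ∧
      ∀ a ∈ A ∩ U, ∀ b ∈ A ∩ U, ρ a b < δ)
    (hfine : ∀ a : B, ∀ V ∈ 𝓝 a, ∃ δ > 0, ∀ b, ρ a b < δ → b ∈ V) :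
    ∃ Ω : Set E, IsGδ Ω ∧ Dense Ω ∧ ∃ g : Ω → B, Continuous g ∧ ∀ e : Ω, ((e : E), g e) ∈ R := by
  obtain ⟨M, hMR, hM⟩ := exists_minimal_closed_relation hR hne
  let small (δ : ℝ) (W : Set E) : Prop :=
    IsOpen W ∧ ∀ e ∈ W, ∀ e' ∈ W, ∀ a b, (e, a) ∈ M → (e', b) ∈ M → ρ a b < δ
  let O : ℕ → Set E := fun n => ⋃₀ {W | small (1 / ((n : ℝ) + 1)) W}
  have hO : ∀ n, IsOpen (O n) := fun n => isOpen_sUnion fun W hW => hW.1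
  have hOd : ∀ n, Dense (O n) := by
    intro n
    rw [dense_iff_inter_open]
    rintro W hW ⟨e, he⟩
    obtain ⟨b, hb⟩ := hM.prop.2 e
    -- Fragment the set of all values of `M` over `W`; minimality then gives an open part of `W`
    -- over which all values lie in the small piece.
    obtain ⟨U, hU, ⟨a, ⟨e', he', ha⟩, haU⟩, hUρ⟩ :=
      hfrag {b | ∃ e ∈ W, (e, b) ∈ M} ⟨b, e, he, hb⟩ (1 / ((n : ℝ) + 1)) (by positivity)
    obtain ⟨W', hW'W, hW'o, ⟨w, hw⟩, hW'U⟩ :=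
      hM.exists_isOpen_subset_of_closed_relation hW hU ⟨e', he', a, haU, ha⟩
    refine ⟨w, hW'W hw, mem_sUnion_of_mem hw ⟨hW'o, fun e₁ h₁ e₂ h₂ a₁ a₂ ha₁ ha₂ => ?_⟩⟩
    exact hUρ a₁ ⟨⟨e₁, hW'W h₁, ha₁⟩, hW'U e₁ h₁ a₁ ha₁⟩ a₂ ⟨⟨e₂, hW'W h₂, ha₂⟩, hW'U e₂ h₂ a₂ ha₂⟩
  choose g hg using hM.prop.2
  refine ⟨⋂ n, O n, .iInter_of_isOpen hO, dense_iInter_of_isOpen hO hOd, fun e => g e, ?_,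
    fun e => hMR (hg e)⟩
  rw [continuous_iff_continuousAt]
  rintro ⟨e, he⟩ V hV
  obtain ⟨δ, hδ, hδV⟩ := hfine _ V hV
  obtain ⟨n, hn⟩ := exists_nat_one_div_lt hδ
  obtain ⟨W, ⟨hWo, hW⟩, heW⟩ := mem_iInter.1 he n
  have : (Subtype.val : (⋂ n, O n : Set E) → E) ⁻¹' W ∈ 𝓝 (⟨e, he⟩ : (⋂ n, O n : Set E)) :=
    (hWo.preimage continuous_subtype_val).mem_nhds heW
  refine mem_map.2 (mem_of_superset this fun e' he' => hδV _ ?_)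
  exact (hW e heW e' he' _ _ (hg _) (hg _)).trans hn

end Selection

/-! ### Representing functionals on `X` along `f` with error `4ε`. -/

section Stability

open Set Filter Topology

variable {X Y : Type*} [NormedAddCommGroup X] [NormedSpace ℝ X]
  [NormedAddCommGroup Y] [NormedSpace ℝ Y]

/-- The closed unit ball of the dual of `X`, with the weak-star topology. -/
abbrev weakStarBall (X : Type*) [NormedAddCommGroup X] [NormedSpace ℝ X] : Set (WeakDual ℝ X) :=
  WeakDual.toStrongDual ⁻¹' Metric.closedBall (0 : StrongDual ℝ X) 1

instance : LocallyConvexSpace ℝ (WeakDual ℝ X) :=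
  WeakBilin.locallyConvexSpace (B := topDualPairing ℝ X)

theorem isCompact_weakStarBall : IsCompact (weakStarBall X) :=
  WeakDual.isCompact_closedBall 0 1

instance : CompactSpace (weakStarBall X) :=
  isCompact_iff_compactSpace.1 isCompact_weakStarBall

theorem convex_weakStarBall : Convex ℝ (weakStarBall X) :=
  (convex_closedBall (0 : StrongDual ℝ X) 1).linear_preimage
    (WeakDual.toStrongDual : WeakDual ℝ X ≃ₗ[ℝ] StrongDual ℝ X).toLinearMap

theorem abs_apply_le_of_mem_weakStarBall {φ : WeakDual ℝ X} (hφ : φ ∈ weakStarBall X) (x : X) :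
    |φ x| ≤ ‖x‖ := by
  have h : ‖WeakDual.toStrongDual φ‖ ≤ 1 := by simpa using hφ
  simpa using (WeakDual.toStrongDual φ).le_of_opNorm_le h x

/-- The functionals in the unit ball of `Y*` which represent `s` along `f`, up to the error `c`. -/
def approxRelation (f : X → Y) (c : ℝ) : Set (WeakDual ℝ X × weakStarBall Y) :=
  {p | ∀ x, |(p.2 : WeakDual ℝ Y) (f x) - p.1 x| ≤ c}

theorem isClosed_approxRelation (f : X → Y) (c : ℝ) : IsClosed (approxRelation f c) := by
  have : approxRelation f c =
      ⋂ x, {p : WeakDual ℝ X × weakStarBall Y | |(p.2 : WeakDual ℝ Y) (f x) - p.1 x| ≤ c} := by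
    ext p
    simp [approxRelation]
  rw [this]
  refine isClosed_iInter fun x => isClosed_le ?_ continuous_const
  exact (((WeakDual.eval_continuous (f x)).comp
    (continuous_subtype_val.comp continuous_snd)).sub
      ((WeakDual.eval_continuous x).comp continuous_fst)).abs

theorem isClosed_image_fst_approxRelation (f : X → Y) (c : ℝ) :
    IsClosed (Prod.fst '' approxRelation f c) :=
  isClosedMap_fst_of_compactSpace _ (isClosed_approxRelation f c)

theorem convex_image_fst_approxRelation (f : X → Y) (c : ℝ) :
    Convex ℝ (Prod.fst '' approxRelation f c) := by
  rintro _ ⟨⟨s, φ⟩, hs, rfl⟩ _ ⟨⟨t, ψ⟩, ht, rfl⟩ a b ha hb hab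
  refine ⟨(a • s + b • t, ⟨a • (φ : WeakDual ℝ Y) + b • (ψ : WeakDual ℝ Y),
    convex_weakStarBall φ.2 ψ.2 ha hb hab⟩), fun x => ?_, rfl⟩
  have h1 := abs_le.1 (hs x)
  have h2 := abs_le.1 (ht x)
  simp only at h1 h2
  change |(a * (φ : WeakDual ℝ Y) (f x) + b * (ψ : WeakDual ℝ Y) (f x)) -
    (a * s x + b * t x)| ≤ c
  have h3 : a * c + b * c = c := by rw [← add_mul, hab, one_mul]
  rw [abs_le]
  constructor
  · nlinarith [mul_le_mul_of_nonneg_left h1.1 ha, mul_le_mul_of_nonneg_left h2.1 hb]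
  · nlinarith [mul_le_mul_of_nonneg_left h1.2 ha, mul_le_mul_of_nonneg_left h2.2 hb]

namespace IsStandardEpsIsometry

section Norm

variable {X Y : Type*} [NormedAddCommGroup X] [NormedAddCommGroup Y] {ε : ℝ} {f : X → Y}

theorem norm_sub_le (hf : IsStandardEpsIsometry ε f) (x y : X) :
    ‖f x - f y‖ ≤ ‖x - y‖ + ε := by
  have := (abs_le.1 (hf.abs_sub_le x y)).2
  linarith

theorem le_norm_sub (hf : IsStandardEpsIsometry ε f) (x y : X) :
    ‖x - y‖ - ε ≤ ‖f x - f y‖ := by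
  have := (abs_le.1 (hf.abs_sub_le x y)).1
  linarith

theorem norm_le (hf : IsStandardEpsIsometry ε f) (x : X) : ‖f x‖ ≤ ‖x‖ + ε := by
  simpa [hf.map_zero] using hf.norm_sub_le x 0

theorem comp_subtypeVal {X : Type*} [NormedAddCommGroup X] [NormedSpace ℝ X] {f : X → Y}
    (hf : IsStandardEpsIsometry ε f) (F : Submodule ℝ X) :
    IsStandardEpsIsometry ε fun x : F => f x :=
  ⟨by simpa using hf.map_zero, fun x y => by simpa using hf.abs_sub_le x y⟩

end Norm

variable {ε : ℝ} {f : X → Y}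

theorem apply_sub_le {X : Type*} [NormedAddCommGroup X] {f : X → Y}
    (hf : IsStandardEpsIsometry ε f) {φ : WeakDual ℝ Y} (hφ : φ ∈ weakStarBall Y) (x y : X) : φ (f x) - φ (f y) ≤ ‖x - y‖ + ε := by
  rw [← map_sub]
  exact ((le_abs_self _).trans (abs_apply_le_of_mem_weakStarBall hφ _)).trans (hf.norm_sub_le x y)

/-- A functional almost norming the images of a segment through the origin. -/
theorem exists_functional_segment (hf : IsStandardEpsIsometry ε f) (u : X) {r : ℝ} (hr : 0 ≤ r) :
    ∃ φ ∈ weakStarBall Y, ∀ t : ℝ, |t| ≤ r → |φ (f (t • u)) - t * ‖u‖| ≤ 3 * ε := by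
  -- The total increment of `φ ∘ f` over the segment is at least its length minus `ε`, while each
  -- partial increment is at most its length plus `ε`. One lower bound and two upper bounds give
  -- `3ε`.
  obtain ⟨g, hg, hgf⟩ := exists_dual_vector'' ℝ (f (r • u) - f ((-r) • u))
  let φ : WeakDual ℝ Y := StrongDual.toWeakDual g
  have hφ : φ ∈ weakStarBall Y := by simpa [φ] using hg
  have hnorm : ∀ s t : ℝ, t ≤ s → ‖s • u - t • u‖ = (s - t) * ‖u‖ := by
    intro s t hst
    rw [← sub_smul, norm_smul, Real.norm_of_nonneg (by linarith)]
  have h0 : φ (f (r • u)) - φ (f ((-r) • u)) = ‖f (r • u) - f ((-r) • u)‖ := by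
    rw [← map_sub]
    exact hgf
  have h1 := hf.le_norm_sub (r • u) ((-r) • u)
  rw [hnorm r (-r) (by linarith)] at h1
  have hf0 : φ (f 0) = 0 := by rw [hf.map_zero]; exact _root_.map_zero φ
  have h2 := hf.apply_sub_le hφ (r • u) ((0 : ℝ) • u)
  have h3 := hf.apply_sub_le hφ ((0 : ℝ) • u) ((-r) • u)
  rw [hnorm _ _ (by linarith), zero_smul, hf0] at h2 h3
  refine ⟨φ, hφ, fun t ht => ?_⟩
  obtain ⟨ht1, ht2⟩ := abs_le.1 ht
  have h4 := hf.apply_sub_le hφ (r • u) (t • u)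
  have h5 := hf.apply_sub_le hφ (t • u) ((-r) • u)
  rw [hnorm _ _ (by linarith)] at h4 h5
  rw [abs_le]
  constructor <;> linarith

/-- A functional almost norming the image of a line through the origin. -/
theorem exists_functional_line (hf : IsStandardEpsIsometry ε f) (u : X) :
    ∃ φ ∈ weakStarBall Y, ∀ t : ℝ, |φ (f (t • u)) - t * ‖u‖| ≤ 3 * ε := by
  let C : ℕ → Set (WeakDual ℝ Y) := fun n =>
    weakStarBall Y ∩ ⋂ t : ℝ, {φ | |t| ≤ n → |φ (f (t • u)) - t * ‖u‖| ≤ 3 * ε}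
  have hC : ∀ n, IsClosed (C n) := by
    refine fun n => isCompact_weakStarBall.isClosed.inter (isClosed_iInter fun t => ?_)
    by_cases ht : |t| ≤ n
    · simp only [ht, forall_const]
      exact isClosed_le (((WeakDual.eval_continuous _).sub continuous_const).abs) continuous_const
    · simp [ht]
  obtain ⟨φ, hφ⟩ := IsCompact.nonempty_iInter_of_sequence_nonempty_isCompact_isClosed C
    (fun n φ hφ => ⟨hφ.1, mem_iInter.2 fun t ht => mem_iInter.1 hφ.2 t (ht.trans (by simp))⟩)
    (fun n => by
      obtain ⟨φ, hφ, h⟩ := hf.exists_functional_segment u n.cast_nonneg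
      exact ⟨φ, hφ, mem_iInter.2 h⟩)
    (isCompact_weakStarBall.of_isClosed_subset (hC 0) inter_subset_left) hC
  rw [mem_iInter] at hφ
  refine ⟨φ, (hφ 0).1, fun t => ?_⟩
  obtain ⟨n, hn⟩ := exists_nat_ge |t|
  exact mem_iInter.1 (hφ n).2 t hn

/-- The derivative of the norm at a smooth point is represented by a functional along `f`. -/
theorem fderiv_norm_mem (hf : IsStandardEpsIsometry ε f) {u : X}
    (hu : DifferentiableAt ℝ (fun x : X => ‖x‖) u) :
    StrongDual.toWeakDual (fderiv ℝ (fun x : X => ‖x‖) u) ∈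
      Prod.fst '' approxRelation f (4 * ε) := by
  obtain ⟨φ, hφ, h⟩ := hf.exists_functional_line u
  refine ⟨(_, ⟨φ, hφ⟩), fun x => ?_, rfl⟩
  change |φ (f x) - fderiv ℝ (fun x : X => ‖x‖) u x| ≤ 4 * ε
  -- By homogeneity this is the difference quotient at `u` with step `1/t`. Comparing `f x` with `f
  -- (t u)` and `f (-t u)` costs one more `ε` beyond the `3ε` along the line.
  have hlim : ∀ v : X, Tendsto (fun t : ℝ => ‖t • u + v‖ - t * ‖u‖) atTop
      (𝓝 (fderiv ℝ (fun x : X => ‖x‖) u v)) := by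
    intro v
    refine (hu.hasFDerivAt.lim v (c := fun t : ℝ => t) tendsto_norm_atTop_atTop).congr' ?_
    filter_upwards [eventually_gt_atTop 0] with t ht
    have : ‖t • u + v‖ = t * ‖u + t⁻¹ • v‖ := by
      rw [← abs_of_pos ht, ← Real.norm_eq_abs, ← norm_smul, Real.norm_of_nonneg ht.le, smul_add,
        smul_inv_smul₀ ht.ne']
    rw [this, smul_eq_mul, mul_sub]
  rw [abs_le]
  constructor
  · have := ge_of_tendsto (hlim (-x)) (b := -φ (f x) - 4 * ε) (Eventually.of_forall fun t => by
      have h1 := (abs_le.1 (h t)).1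
      have h2 := hf.apply_sub_le hφ (t • u) x
      rw [← sub_eq_add_neg]
      linarith)
    rw [map_neg] at this
    linarith
  · have := ge_of_tendsto (hlim x) (b := φ (f x) - 4 * ε) (Eventually.of_forall fun t => by
      have h1 := (abs_le.1 (h (-t))).2
      have h2 := hf.apply_sub_le hφ x ((-t) • u)
      rw [neg_smul, sub_neg_eq_add, add_comm x] at h2
      rw [neg_smul] at h1
      linarith)
    linarith

/-- A functional outside the closed convex image would be separated from it by evaluation at some
`v`. The derivative of the norm at a smooth point near `v` lies in the image and nearly attains
`‖v‖` at `v`. -/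
theorem weakStarBall_subset_of_finiteDimensional [FiniteDimensional ℝ X]
    (hf : IsStandardEpsIsometry ε f) :
    weakStarBall X ⊆ Prod.fst '' approxRelation f (4 * ε) := by
  intro s hs
  by_contra hcon
  obtain ⟨l, a, hl, has⟩ := geometric_hahn_banach_closed_point
    (convex_image_fst_approxRelation f (4 * ε)) (isClosed_image_fst_approxRelation f (4 * ε)) hcon
  obtain ⟨v, rfl⟩ := LinearMap.dualEmbedding_surjective (topDualPairing ℝ X) l
  replace hl : ∀ t ∈ Prod.fst '' approxRelation f (4 * ε), t v < a := hl
  replace has : a < s v := has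
  have hsv : s v ≤ ‖v‖ := (le_abs_self _).trans (abs_apply_le_of_mem_weakStarBall hs v)
  obtain ⟨u, hu, huv⟩ := (dense_differentiableAt_norm (E := X)).exists_dist_lt v
    (show 0 < (s v - a) / 2 by linarith)
  have h1 := hl _ (hf.fderiv_norm_mem hu)
  have h2 : fderiv ℝ (fun x : X => ‖x‖) u u = ‖u‖ := DifferentiableAt.fderiv_norm_self hu
  have h3 : |fderiv ℝ (fun x : X => ‖x‖) u (v - u)| ≤ 1 * ‖v - u‖ :=
    ContinuousLinearMap.le_of_opNorm_le _ (by
      simpa using norm_fderiv_le_of_lipschitz ℝ (f := fun x : X => ‖x‖) (x₀ := u)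
        lipschitzWith_one_norm) _
  rw [map_sub, h2, one_mul] at h3
  rw [StrongDual.toWeakDual_apply] at h1
  rw [dist_eq_norm] at huv
  have h4 := norm_sub_norm_le v u
  have h5 := (abs_le.1 h3).1
  linarith

/-- Every functional in the unit ball of `X*` is represented along `f`, up to `4ε`, by a functional
in the unit ball of `Y*`. -/
theorem exists_functional (hf : IsStandardEpsIsometry ε f) {s : WeakDual ℝ X}
    (hs : s ∈ weakStarBall X) :
    ∃ φ : weakStarBall Y, (s, φ) ∈ approxRelation f (4 * ε) := by
  classical
  let C : Finset X → Set (weakStarBall Y) := fun I =>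
    {φ | ∀ x ∈ I, |(φ : WeakDual ℝ Y) (f x) - s x| ≤ 4 * ε}
  have hC : ∀ I, IsClosed (C I) := by
    intro I
    have : C I = ⋂ x ∈ I, {φ : weakStarBall Y | |(φ : WeakDual ℝ Y) (f x) - s x| ≤ 4 * ε} := by
      ext φ
      simp only [C, mem_ofPred_eq, mem_iInter]
    rw [this]
    exact isClosed_biInter fun x _ => isClosed_le
      ((((WeakDual.eval_continuous (f x)).comp continuous_subtype_val).sub continuous_const).abs)
      continuous_const
  have hne : ∀ I, (C I).Nonempty := by
    intro I
    -- Only the values of `s` on `I` matter here, so the finite-dimensional case applies to `f` and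
    -- `s` restricted to the span.
    let F := Submodule.span ℝ (I : Set X)
    have : FiniteDimensional ℝ F := FiniteDimensional.span_finset ℝ I
    let t : StrongDual ℝ F := (WeakDual.toStrongDual s).comp F.subtypeL
    have ht : StrongDual.toWeakDual t ∈ weakStarBall F := by
      have : ‖t‖ ≤ 1 := t.opNorm_le_bound zero_le_one fun x => by
        rw [one_mul]
        exact abs_apply_le_of_mem_weakStarBall hs (x : X)
      simpa using this
    obtain ⟨⟨_, φ⟩, hφ, rfl⟩ := (hf.comp_subtypeVal F).weakStarBall_subset_of_finiteDimensional ht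
    exact ⟨φ, fun x hx => hφ ⟨x, Submodule.subset_span hx⟩⟩
  obtain ⟨φ, hφ⟩ := IsCompact.nonempty_iInter_of_directed_nonempty_isCompact_isClosed C
    (fun I J => ⟨I ∪ J, fun φ hφ x hx => hφ x (Finset.mem_union_left _ hx),
      fun φ hφ x hx => hφ x (Finset.mem_union_right _ hx)⟩) hne (fun I => (hC I).isCompact) hC
  exact ⟨φ, fun x => mem_iInter.1 hφ {x} x (Finset.mem_singleton_self x)⟩

end IsStandardEpsIsometry

end Stability

/-! ### From families of functionals to operators of norm one. -/

section Operators

open Set Filter Topology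

variable {X Y : Type*} [NormedAddCommGroup X] [NormedSpace ℝ X]
  [NormedAddCommGroup Y] [NormedSpace ℝ Y] {Ω : Set (WeakDual ℝ X)}

/-- The bound defines a weak-star closed convex set, so by Krein–Milman it passes from `Ω` to the
whole dual ball. -/
theorem IsWeakStarDenseInExt.norm_le (hΩ : IsWeakStarDenseInExt Ω) {x : X} {c : ℝ}
    (h : ∀ ω ∈ Ω, |ω x| ≤ c) : ‖x‖ ≤ c := by
  let D : Set (WeakDual ℝ X) := {φ | |φ x| ≤ c}
  have hDcl : IsClosed D := isClosed_le (WeakDual.eval_continuous x).abs continuous_const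
  have hDc : Convex ℝ D := by
    intro φ hφ ψ hψ a b ha hb hab
    have h1 := abs_le.1 (show |φ x| ≤ c from hφ)
    have h2 := abs_le.1 (show |ψ x| ≤ c from hψ)
    change |a * φ x + b * ψ x| ≤ c
    have h3 : a * c + b * c = c := by rw [← add_mul, hab, one_mul]
    rw [abs_le]
    constructor
    · nlinarith [mul_le_mul_of_nonneg_left h1.1 ha, mul_le_mul_of_nonneg_left h2.1 hb]
    · nlinarith [mul_le_mul_of_nonneg_left h1.2 ha, mul_le_mul_of_nonneg_left h2.2 hb]
  have hball : weakStarBall X ⊆ D := by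
    rw [← closure_convexHull_extremePoints isCompact_weakStarBall convex_weakStarBall]
    exact closure_minimal
      (convexHull_min (hΩ.dense.trans (closure_minimal h hDcl)) hDc) hDcl
  obtain ⟨g, hg, hgx⟩ := exists_dual_vector'' ℝ x
  have hgD : |g x| ≤ c :=
    hball (show StrongDual.toWeakDual g ∈ weakStarBall X by simpa using hg)
  calc ‖x‖ = g x := hgx.symm
    _ ≤ |g x| := le_abs_self _
    _ ≤ c := hgD

theorem IsWeakStarDenseInExt.nonempty (hΩ : IsWeakStarDenseInExt Ω) : Ω.Nonempty := by
  by_contra h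
  rw [not_nonempty_iff_eq_empty] at h
  -- Over an empty `Ω` even a negative bound would hold vacuously.
  have := hΩ.norm_le (x := 0) (c := -1) (by simp [h])
  rw [norm_zero] at this
  linarith

/-- The operator `Y → ℓ∞(Ω)` given by a family of functionals in the unit ball of `Y*`. -/
noncomputable def linftyOfFamily (g : Ω → weakStarBall Y) : Y →L[ℝ] lp (fun _ : Ω => ℝ) ∞ :=
  LinearMap.mkContinuous
    { toFun := fun y => ⟨fun ω => (g ω : WeakDual ℝ Y) y, memℓp_infty ⟨‖y‖, by
        rintro _ ⟨ω, rfl⟩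
        exact abs_apply_le_of_mem_weakStarBall (g ω).2 y⟩⟩
      map_add' := fun y z => by
        ext ω
        exact map_add (g ω : WeakDual ℝ Y) y z
      map_smul' := fun a y => by
        ext ω
        exact map_smul (g ω : WeakDual ℝ Y) a y } 1 fun y => by
    rw [one_mul]
    exact lp.norm_le_of_forall_le (norm_nonneg y) fun ω =>
      abs_apply_le_of_mem_weakStarBall (g ω).2 y

/-- The operator `Y → C(Ω, w*)` given by a continuous family of functionals in the unit ball of
`Y*`. -/
noncomputable def bcfOfFamily (g : Ω → weakStarBall Y) (hg : Continuous g) : Y →L[ℝ] (Ω →ᵇ ℝ) :=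
  LinearMap.mkContinuous
    { toFun := fun y => BoundedContinuousFunction.ofNormedAddCommGroup
        (fun ω => (g ω : WeakDual ℝ Y) y)
        ((WeakDual.eval_continuous y).comp (continuous_subtype_val.comp hg)) ‖y‖
        (fun ω => abs_apply_le_of_mem_weakStarBall (g ω).2 y)
      map_add' := fun y z => by
        ext ω
        exact map_add (g ω : WeakDual ℝ Y) y z
      map_smul' := fun a y => by
        ext ω
        exact map_smul (g ω : WeakDual ℝ Y) a y } 1 fun y => by
    rw [one_mul]
    exact (BoundedContinuousFunction.norm_le (norm_nonneg y)).2 fun ω =>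
      abs_apply_le_of_mem_weakStarBall (g ω).2 y

namespace IsStandardEpsIsometry

variable {ε : ℝ} {f : X → Y}

theorem one_le_of_forall_abs_apply_le [Nontrivial X] (hf : IsStandardEpsIsometry ε f)
    (hΩ : IsWeakStarDenseInExt Ω) {g : Ω → weakStarBall Y}
    (hg : ∀ ω : Ω, ((ω : WeakDual ℝ X), g ω) ∈ approxRelation f (4 * ε)) {c : ℝ}
    (hc : ∀ (ω : Ω) (y : Y), |(g ω : WeakDual ℝ Y) y| ≤ c * ‖y‖) : 1 ≤ c := by
  by_contra! hc1
  have hε : 0 ≤ ε := (abs_nonneg _).trans (hf.abs_sub_le 0 0)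
  have hd1 : max c 0 < 1 := max_lt hc1 one_pos
  -- With `c' = max c 0 < 1`, the estimate `‖x‖ ≤ c' (‖x‖ + ε) + 4ε` forces `(1 - c') ‖x‖ ≤ 5ε`,
  -- which fails for large `x`.
  obtain ⟨x, hx⟩ := NormedSpace.exists_lt_norm ℝ X (5 * ε / (1 - max c 0))
  rw [div_lt_iff₀ (by linarith)] at hx
  have h1 : ‖x‖ ≤ max c 0 * (‖x‖ + ε) + 4 * ε := by
    refine hΩ.norm_le fun ω hω => ?_
    have h2 := abs_sub_abs_le_abs_sub (ω x) ((g ⟨ω, hω⟩ : WeakDual ℝ Y) (f x))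
    have h3 := hg ⟨ω, hω⟩ x
    rw [abs_sub_comm] at h2
    have h4 : |(g ⟨ω, hω⟩ : WeakDual ℝ Y) (f x)| ≤ max c 0 * (‖x‖ + ε) :=
      (hc ⟨ω, hω⟩ (f x)).trans
        (mul_le_mul (le_max_left _ _) (hf.norm_le x) (norm_nonneg _) (le_max_right _ _))
    linarith
  nlinarith [mul_le_mul_of_nonneg_right hd1.le hε]

/-- A family of functionals representing `Ω` along `f` can be replaced by one which generates an
operator of norm at least one. -/
theorem exists_norming_family [Nontrivial Y] (hf : IsStandardEpsIsometry ε f)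
    (hΩ : IsWeakStarDenseInExt Ω) (g : Ω → weakStarBall Y)
    (hg : ∀ ω : Ω, ((ω : WeakDual ℝ X), g ω) ∈ approxRelation f (4 * ε)) :
    ∃ g' : Ω → weakStarBall Y, (Continuous g → Continuous g') ∧
      (∀ (ω : Ω) (x : X), |(g' ω : WeakDual ℝ Y) (f x) - (ω : WeakDual ℝ X) x| ≤ 4 * ε) ∧
      ∀ c : ℝ, (∀ (ω : Ω) (y : Y), |(g' ω : WeakDual ℝ Y) y| ≤ c * ‖y‖) → 1 ≤ c := by
  -- If `X = 0` the given family may vanish; since `f 0 = 0`, any constant functional represents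
  -- `Ω`, and one norming a nonzero `y` is used.
  rcases subsingleton_or_nontrivial X with hX | hX
  · have hε : 0 ≤ ε := (abs_nonneg _).trans (hf.abs_sub_le 0 0)
    obtain ⟨y, hy⟩ := exists_ne (0 : Y)
    obtain ⟨φ, hφ, hφy⟩ := exists_dual_vector'' ℝ y
    refine ⟨fun _ => ⟨StrongDual.toWeakDual φ, by simpa using hφ⟩, fun _ => continuous_const,
      fun ω x => ?_, fun c hc => ?_⟩
    · rw [Subsingleton.elim x 0, hf.map_zero, _root_.map_zero, _root_.map_zero, sub_zero, abs_zero]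
      linarith
    · obtain ⟨ω, hω⟩ := hΩ.nonempty
      have h1 : |φ y| ≤ c * ‖y‖ := hc ⟨ω, hω⟩ y
      rw [hφy, RCLike.ofReal_real_eq_id, id, abs_norm] at h1
      exact le_of_mul_le_mul_right (by rwa [one_mul]) (norm_pos_iff.2 hy)
  · exact ⟨g, id, hg, fun c hc => hf.one_le_of_forall_abs_apply_le hΩ hg hc⟩

theorem exists_linfty_operator [Nontrivial Y] (hf : IsStandardEpsIsometry ε f)
    (hΩ : IsWeakStarDenseInExt Ω) :
    ∃ T : Y →L[ℝ] lp (fun _ : Ω => ℝ) ∞,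
      ‖T‖ = 1 ∧ ∀ x : X, ‖T (f x) - canonicalLinfty hΩ.subset x‖ ≤ 4 * ε := by
  have hε : 0 ≤ ε := (abs_nonneg _).trans (hf.abs_sub_le 0 0)
  choose g₀ hg₀ using fun ω : Ω => hf.exists_functional (s := ω) (hΩ.subset ω.2).1
  obtain ⟨g, -, hg, hnorm⟩ := hf.exists_norming_family hΩ g₀ hg₀
  refine ⟨linftyOfFamily g, le_antisymm (LinearMap.mkContinuous_norm_le _ zero_le_one _)
    (hnorm _ fun ω y => ?_), fun x => lp.norm_le_of_forall_le (by linarith) fun ω => hg ω x⟩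
  exact (lp.norm_apply_le_norm ENNReal.top_ne_zero (linftyOfFamily g y) ω).trans
    ((linftyOfFamily g).le_opNorm y)

theorem exists_bcf_operator [Nontrivial Y] (hf : IsStandardEpsIsometry ε f)
    (hΩ : IsWeakStarDenseInExt Ω) (g₀ : Ω → weakStarBall Y) (hgc : Continuous g₀)
    (hg₀ : ∀ ω : Ω, ((ω : WeakDual ℝ X), g₀ ω) ∈ approxRelation f (4 * ε)) :
    ∃ T : Y →L[ℝ] (Ω →ᵇ ℝ),
      ‖T‖ = 1 ∧ ∀ x : X, ‖T (f x) - canonicalBCF hΩ.subset x‖ ≤ 4 * ε := by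
  have hε : 0 ≤ ε := (abs_nonneg _).trans (hf.abs_sub_le 0 0)
  obtain ⟨g, hc, hg, hnorm⟩ := hf.exists_norming_family hΩ g₀ hg₀
  refine ⟨bcfOfFamily g (hc hgc), le_antisymm (LinearMap.mkContinuous_norm_le _ zero_le_one _)
    (hnorm _ fun ω y => ?_),
    fun x => (BoundedContinuousFunction.norm_le (by linarith)).2 fun ω => hg ω x⟩
  exact ((bcfOfFamily g (hc hgc) y).norm_coe_le_norm ω).trans
    ((bcfOfFamily g (hc hgc)).le_opNorm y)

end IsStandardEpsIsometry

/-- The weak-star compact dual ball of a separable space, or of a space whose dual has the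
weak-star PCP, is fragmented by a distance finer than the weak-star topology. -/
theorem exists_fragmenting_weakStarBall
    (hY : HasWeakStarPCP Y ∨ TopologicalSpace.SeparableSpace Y) :
    ∃ ρ : weakStarBall Y → weakStarBall Y → ℝ,
      (∀ A : Set (weakStarBall Y), A.Nonempty → ∀ δ > 0, ∃ U, IsOpen U ∧ (A ∩ U).Nonempty ∧
        ∀ a ∈ A ∩ U, ∀ b ∈ A ∩ U, ρ a b < δ) ∧
      ∀ a : weakStarBall Y, ∀ V ∈ 𝓝 a, ∃ δ > 0, ∀ b, ρ a b < δ → b ∈ V := by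
  rcases hY with hY | hY
  · let toDual : weakStarBall Y → StrongDual ℝ Y := fun a => WeakDual.toStrongDual (a : WeakDual ℝ Y)
    refine ⟨fun a b => dist (toDual a) (toDual b), fun A hA δ hδ => ?_, fun a V hV => ?_⟩
    · have hbdd : Bornology.IsBounded (toDual '' A) := by
        refine (Metric.isBounded_closedBall (x := (0 : StrongDual ℝ Y)) (r := 1)).subset ?_
        rintro _ ⟨a, -, rfl⟩
        exact a.2
      obtain ⟨U, hU, ⟨_, ⟨a, ha, rfl⟩, haU⟩, hdiam⟩ := hY _ (hA.image toDual) hbdd δ hδ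
      refine ⟨Subtype.val ⁻¹' U, hU.preimage continuous_subtype_val, ⟨a, ha, haU⟩, ?_⟩
      rintro b ⟨hb, hbU⟩ c ⟨hc, hcU⟩
      exact (Metric.dist_le_diam_of_mem (hbdd.subset inter_subset_left)
        ⟨mem_image_of_mem _ hb, hbU⟩ ⟨mem_image_of_mem _ hc, hcU⟩).trans_lt hdiam
    · rw [nhds_subtype, mem_comap] at hV
      obtain ⟨V', hV', hsub⟩ := hV
      have h1 : StrongDual.toWeakDual ⁻¹' V' ∈ 𝓝 (toDual a) :=
        NormedSpace.Dual.toWeakDual_continuous.continuousAt.preimage_mem_nhds hV'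
      obtain ⟨δ, hδ, hball⟩ := Metric.mem_nhds_iff.1 h1
      refine ⟨δ, hδ, fun b hb => hsub ?_⟩
      exact hball (Metric.mem_ball'.2 hb)
  · have := WeakDual.metrizable_of_isCompact ℝ Y (weakStarBall Y) isCompact_weakStarBall
    let := TopologicalSpace.metrizableSpaceMetric (weakStarBall Y)
    refine ⟨dist, fun A ⟨a, ha⟩ δ hδ => ?_, fun a V hV => ?_⟩
    · refine ⟨Metric.ball a (δ / 2), Metric.isOpen_ball,
        ⟨a, ha, Metric.mem_ball_self (by linarith)⟩, fun b hb c hc => ?_⟩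
      have h1 := Metric.mem_ball.1 hb.2
      have h2 := Metric.mem_ball.1 hc.2
      have h3 := dist_triangle_right b c a
      linarith
    · obtain ⟨δ, hδ, hball⟩ := Metric.mem_nhds_iff.1 hV
      exact ⟨δ, hδ, fun b hb => hball (by rwa [Metric.mem_ball, dist_comm])⟩

/-- The selection theorem applies over the Baire space of extreme points: the relation is weak-star
closed, and the stability estimate makes its fibres nonempty. -/
theorem IsStandardEpsIsometry.exists_isGδ_continuous_family {ε : ℝ} {f : X → Y}
    (hf : IsStandardEpsIsometry ε f)
    (hY : HasWeakStarPCP Y ∨ TopologicalSpace.SeparableSpace Y) :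
    ∃ Ω : Set (WeakDual ℝ X), IsWeakStarDenseInExt Ω ∧
      IsGδ ((Subtype.val : dualBallExt X → WeakDual ℝ X) ⁻¹' Ω) ∧
      ∃ g : Ω → weakStarBall Y, Continuous g ∧
        ∀ ω : Ω, ((ω : WeakDual ℝ X), g ω) ∈ approxRelation f (4 * ε) := by
  obtain ⟨ρ, hfrag, hfine⟩ := exists_fragmenting_weakStarBall hY
  have : BaireSpace (dualBallExt X) :=
    baireSpace_extremePoints isCompact_weakStarBall convex_weakStarBall
  obtain ⟨O, hO, hOd, g, hg, hgR⟩ := exists_continuous_selection_of_fragmented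
    (E := dualBallExt X) (B := weakStarBall Y)
    (R := {p | ((p.1 : WeakDual ℝ X), p.2) ∈ approxRelation f (4 * ε)})
    ((isClosed_approxRelation f (4 * ε)).preimage (by fun_prop))
    (fun e => hf.exists_functional e.2.1) ρ hfrag hfine
  have hmem : ∀ ω : (Subtype.val '' O : Set (WeakDual ℝ X)),
      ∃ h : (ω : WeakDual ℝ X) ∈ dualBallExt X, (⟨ω, h⟩ : dualBallExt X) ∈ O := by
    rintro ⟨_, ω, hω, rfl⟩
    exact ⟨ω.2, hω⟩
  refine ⟨Subtype.val '' O, ⟨?_, Subtype.dense_iff.1 hOd⟩, ?_,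
    fun ω => g ⟨⟨ω, (hmem ω).1⟩, (hmem ω).2⟩, ?_, fun ω => hgR _⟩
  · rintro _ ⟨ω, -, rfl⟩
    exact ω.2
  · rwa [preimage_image_eq _ Subtype.val_injective]
  · exact hg.comp ((continuous_subtype_val.subtype_mk _).subtype_mk _)

end Operators

theorem theorem2p4 {X : Type*} {Y : Type*}
    [NormedAddCommGroup X] [NormedSpace ℝ X] [CompleteSpace X]
    [NormedAddCommGroup Y] [NormedSpace ℝ Y] [CompleteSpace Y] [Nontrivial Y]
    (ε : ℝ) (hε : 0 ≤ ε) (f : X → Y) (hf : IsStandardEpsIsometry ε f) :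
    (∀ (Ω : Set (WeakDual ℝ X)) (hΩ : IsWeakStarDenseInExt Ω),
      ∃ T : Y →L[ℝ] lp (fun _ : Ω => ℝ) ∞,
        ‖T‖ = 1 ∧ ∀ x : X, ‖T (f x) - canonicalLinfty hΩ.subset x‖ ≤ 4 * ε) ∧
    ((HasWeakStarPCP Y ∨ TopologicalSpace.SeparableSpace Y) →
      ∃ (Ω : Set (WeakDual ℝ X)) (hΩ : IsWeakStarDenseInExt Ω),
        IsGδ ((Subtype.val : dualBallExt X → WeakDual ℝ X) ⁻¹' Ω) ∧
        ∃ T : Y →L[ℝ] (Ω →ᵇ ℝ),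
          ‖T‖ = 1 ∧ ∀ x : X, ‖T (f x) - canonicalBCF hΩ.subset x‖ ≤ 4 * ε) := by
  refine ⟨fun Ω hΩ => hf.exists_linfty_operator hΩ, fun hY => ?_⟩
  obtain ⟨Ω, hΩ, hGδ, g, hgc, hg⟩ := hf.exists_isGδ_continuous_family hY
  exact ⟨Ω, hΩ, hGδ, hf.exists_bcf_operator hΩ g hgc hg⟩
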